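/- Let $d\ge 1$ and let $\gamma_1,\dots,\gamma_{d-1}$ be fixed positive integers; put $\Gamma=\{1,\gamma_1,\dots,\gamma_{d-1}\}$ (repetitions allowed) and $\gamma_0=1$. For $n\ge 1$ let $C_n^\Gamma$ be the circulant (multi)graph on $\mathbb{Z}/n\mathbb{Z}$ with one edge joining $v$ and $v+\gamma_i \bmod n$ for each $v\in\mathbb{Z}/n\mathbb{Z}$ and each $i\in\{0,\dots,d-1\}$; it is $2d$-regular, each $v$ being joined to $v\pm\gamma_i$, counted with multiplicity. Let $\Delta f(x)=\sum_{y\sim x}(f(x)-f(y))$ be its combinatorial Laplacian (neighbours counted with multiplicity), $\det^\ast\Delta_{C_n^\Gamma}$ the product of the non-zero eigenvalues of $\Delta$ with multiplicity, and $\tau(C_n^\Gamma)$ the number of spanning trees. Put $$c_\Gamma=1+\sum_{i=1}^{d-1}\gamma_i^2,\qquad I_0^\Gamma(2t,\dots,2t)=\frac1{2\pi}\int_{-\pi}^{\pi}e^{2t\left(\cos w+\sum_{i=1}^{d-1}\cos\gamma_i w\right)}\,dw,$$ $$\mathcal I_d^\Gamma=\int_0^\infty\left(e^{-t}-e^{-2dt}I_0^\Gamma(2t,\dots,2t)\right)\frac{dt}{t}.$$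 Then the integral $\mathcal I_d^\Gamma$ converges absolutely, and as $n\to\infty$ $$\log\det{}^\ast\Delta_{C_n^\Gamma}=n\,\mathcal I_d^\Gamma+2\log n-\log c_\Gamma+o(1),\qquad \tau(C_n^\Gamma)\sim\frac{n}{c_\Gamma}\,e^{n\,\mathcal I_d^\Gamma}.$$ Moreover, let $(a_n)$ be a real sequence with $\tau(C_n^\Gamma)=n\,a_n^2$ for all large $n$. If $a_n\ge 0$ for all large $n$, then $a_n\sim c\,\phi^n$ for some constants $c,\phi>0$; and whenever $a_n\sim c\,\phi^n$ with real constants $c,\phi$, then $c^2=1/c_\Gamma$. -/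

import Mathlib

open Filter Asymptotics MeasureTheory

noncomputable section

/-- The circulant (multi)graph on the vertices `0, …, n - 1` with generators `p 0, …, p (d - 1)`:
for every vertex `v` and every index `i` there is one edge `(v, i)` joining `v` and
`v + p i` modulo `n`.  Thus `v` is joined to `v ± p i` for every `i`, counted with multiplicity,
and the graph is `2 d`-regular. -/
def circulantMultigraph {d : ℕ} (n : ℕ) (p : Fin d → ℕ) : Graph (Fin n) (Fin n × Fin d) where
  vertexSet := Set.univ
  edgeSet := Set.univ
  IsLink e x y :=
    s(x, y) = s(e.1, (⟨((e.1 : ℕ) + p e.2) % n, Nat.mod_lt _ e.1.pos⟩ : Fin n))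
  isLink_symm e _ := ⟨fun x y h => by rw [Sym2.eq_swap]; exact h⟩
  eq_or_eq_of_isLink_of_isLink e x y v w h h' := by
    rw [← h', Sym2.eq_iff] at h
    tauto
  edge_mem_iff_exists_isLink e := by
    simp only [Set.mem_univ, true_iff]
    exact ⟨_, _, rfl⟩

namespace Graph

variable {α β : Type*}

/-- The number of edges with ends `x` and `y`. -/
def linkCount (G : Graph α β) (x y : α) : ℕ := Set.ncard {e | G.IsLink e x y}

/-- The (real) matrix of the combinatorial Laplacian of a finite multigraph. -/
def laplacian [Fintype α] [DecidableEq α] (G : Graph α β) : Matrix α α ℝ :=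
  Matrix.diagonal (fun x => ∑ y, (G.linkCount x y : ℝ)) -
    Matrix.of (fun x y => (G.linkCount x y : ℝ))

/-- The Laplacian sends `f` to the function `x ↦ ∑ (f x - f y)`, the sum being over the
neighbours `y` of `x`, counted with multiplicity. -/
theorem laplacian_mulVec [Fintype α] [DecidableEq α] (G : Graph α β) (f : α → ℝ) (x : α) :
    (G.laplacian.mulVec f) x = ∑ y, (G.linkCount x y : ℝ) * (f x - f y) := by
  simp only [laplacian, Matrix.sub_mulVec, Pi.sub_apply, Matrix.mulVec_diagonal, mul_sub,
    Finset.sum_sub_distrib, Finset.sum_mul]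
  rfl

theorem linkCount_comm (G : Graph α β) (x y : α) : G.linkCount x y = G.linkCount y x := by
  simp only [linkCount, G.isLink_comm (x := x) (y := y)]

theorem isHermitian_laplacian [Fintype α] [DecidableEq α] (G : Graph α β) :
    G.laplacian.IsHermitian := by
  refine (Matrix.isHermitian_diagonal _).sub ?_
  ext x y
  simp [Matrix.conjTranspose_apply, G.linkCount_comm x y]

/-- The product of the non-zero Laplacian eigenvalues, counted with multiplicity. -/
def detStar [Fintype α] [DecidableEq α] (G : Graph α β) : ℝ :=
  ∏ i with G.isHermitian_laplacian.eigenvalues i ≠ 0, G.isHermitian_laplacian.eigenvalues i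

/-- `F` is the edge set of a spanning tree of `G`: the spanning subgraph with edge set `F` has
no loops and no multiple edges, and it is a tree. -/
def IsSpanningTree (G : Graph α β) (F : Set β) : Prop :=
  F ⊆ G.edgeSet ∧ (G.restrict F).Simple ∧ (G.restrict F).toSimpleGraph.IsTree

/-- The number of spanning trees. -/
def numSpanningTrees (G : Graph α β) : ℕ := Set.ncard {F | G.IsSpanningTree F}

end Graph

/-- The generators `1, γ₁, …, γ_{d-1}`, where `k = d - 1`. -/
def generators {k : ℕ} (γ : Fin k → ℕ) : Fin (k + 1) → ℕ := Fin.cons 1 γ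

/-- The `d`-dimensional modified `I`-Bessel function of order zero with parameters `p`. -/
def besselIZero {d : ℕ} (p : Fin d → ℕ) (u : Fin d → ℝ) : ℝ :=
  1 / (2 * Real.pi) *
    ∫ w in (-Real.pi)..Real.pi, Real.exp (∑ i, u i * Real.cos ((p i : ℝ) * w))

/-- The integrand of the lead term: `(e^{-t} - e^{-2dt} I₀(2t, …, 2t)) / t`. -/
def leadIntegrand {d : ℕ} (p : Fin d → ℕ) (t : ℝ) : ℝ :=
  (Real.exp (-t) - Real.exp (-(2 * (d : ℝ) * t)) * besselIZero p (fun _ => 2 * t)) / t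

/-- The lead term `∫₀^∞ (e^{-t} - e^{-2dt} I₀(2t, …, 2t)) dt/t`. -/
def leadTerm {d : ℕ} (p : Fin d → ℕ) : ℝ := ∫ t in Set.Ioi (0 : ℝ), leadIntegrand p t

/-- The constant `1 + ∑ γᵢ²`. -/
def circConst {k : ℕ} (γ : Fin k → ℕ) : ℝ := 1 + ∑ i, (γ i : ℝ) ^ 2

end

/-!
The lead term, the eigenvalues and the spanning trees are all tied to one function, the symbol
`λ(w) = ∑ i, (2 - 2 cos (p i * w))`, where `p = generators γ`.

*Algebra.* The discrete Fourier transform diagonalises the Laplacian `L` of the circulant graph,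
with eigenvalues `λ(2πj/n)`, `0 ≤ j < n`. Only `j = 0` gives zero, because `1` is a generator, so
`detStar` is the product over `j ≠ 0`. The same transform gives `det (L + J) = n * detStar` for
the all-ones matrix `J`. On the other hand `det (L + J) = n² τ`. For a vertex `r` with indicator
`δᵣ` there is a matrix `M` of determinant `n` with `L + J = Mᵀ (L + δᵣδᵣᵀ) M`. Write
`L + δᵣδᵣᵀ = N Nᵀ` with `N` the oriented incidence matrix enlarged by the column `δᵣ`, and expand
by Cauchy–Binet. A maximal minor is `±1` if it consists of the root column and the columns of
a spanning tree (they generate the integer lattice, since the tree connects everything to `r`),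
and zero otherwise. Hence `detStar = n τ` (`detStar_circulant_eq_mul_numSpanningTrees`).

*Riemann sums.* Since `1 - z` divides `1 - z ^ γ`, the symbol factors as
`λ(w) = (2 - 2 cos w) q(w)`, where `q ≥ 1` is smooth and periodic with `q 0 = 1 + ∑ γᵢ²`
(`circSymbol_generators`). The factors `2 - 2 cos (2πj/n)`, `0 < j < n`, multiply to `n²`. The sum
of `log q` over the points `2πj/n` is `n` times the mean of `log q`, up to the error of the
trapezoidal rule, which is `O(1/n)` after multiplication by `n`. Removing the term `j = 0` produces
the constant `-log (q 0)` (`log_detStar_circulant`, `tendsto_sum_sub_integral_of_periodic`).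

*The lead term.* By Frullani's integral `∫₀^∞ (exp (-t) - exp (-λt)) dt/t = log λ`, and by Fubini
the lead term is the mean of `log λ`. Fubini applies because the Frullani integrand has a constant
sign for fixed `λ`, so the integral of its absolute value is `|log λ|`, which is integrable in `w`.
As `log (2 - 2 cos w)` has mean zero, the lead term is the mean of `log q` (`leadTerm_eq`).
-/

noncomputable section

/-! ### The Cauchy–Binet formula -/

namespace Matrix

variable {m n R : Type*} [Fintype m] [Fintype n] [DecidableEq n] [CommRing R]

theorem det_mul_eq_sum_prod_mul_det (A : Matrix n m R) (B : Matrix m n R) :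
    (A * B).det = ∑ f : n → m, (∏ i, A i (f i)) * (B.submatrix f id).det := by
  have h : (A * B : Matrix n n R) = fun i => ∑ j, A i j • B j := by
    ext i k
    simp [Matrix.mul_apply, Finset.sum_apply]
  have hs : (A * B).det = ∑ f : n → m,
      (detRowAlternating (R := R)).toMultilinearMap fun i => A i (f i) • B (f i) := by
    rw [h]
    exact MultilinearMap.map_sum (detRowAlternating (R := R)).toMultilinearMap
      fun i j => A i j • B j
  rw [hs]
  exact Finset.sum_congr rfl fun f _ => MultilinearMap.map_smul_univ _ _ _

/-- The Cauchy–Binet formula, symmetrised: the sum runs over all functions `f` instead of over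
the subsets of `m` with `card n` elements, so that every minor is counted `(card n)!` times
(non-injective functions contribute zero). -/
theorem factorial_mul_det_mul (A : Matrix n m R) (B : Matrix m n R) :
    ((Fintype.card n).factorial : R) * (A * B).det =
      ∑ f : n → m, (A.submatrix id f).det * (B.submatrix f id).det := by
  have key : ∀ σ : Equiv.Perm n, (A * B).det =
      ∑ f : n → m, (Equiv.Perm.sign σ * ∏ i, A i (f (σ i))) * (B.submatrix f id).det := by
    intro σ
    rw [det_mul_eq_sum_prod_mul_det,
      ← (Equiv.arrowCongr σ.symm (Equiv.refl m)).sum_comp]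
    refine Finset.sum_congr rfl fun f _ => ?_
    have : (B.submatrix ((Equiv.arrowCongr σ.symm (Equiv.refl m)) f) id)
        = (B.submatrix f id).submatrix σ id := by
      ext i j; simp [Equiv.arrowCongr]
    rw [this, det_permute]
    simp [Equiv.arrowCongr]
    ring
  have hs : ((Fintype.card n).factorial : R) * (A * B).det =
      ∑ _σ : Equiv.Perm n, (A * B).det := by
    simp [Finset.card_univ, Fintype.card_perm]
  rw [hs, Finset.sum_congr rfl fun σ _ => key σ, Finset.sum_comm]
  refine Finset.sum_congr rfl fun f _ => ?_
  rw [← Finset.sum_mul, ← det_transpose (A.submatrix id f), det_apply' (A.submatrix id f)ᵀ]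
  simp

end Matrix

/-! ### The matrix-tree theorem for multigraphs -/

theorem card_injective_range_eq {V M : Type*} [Fintype V] [DecidableEq V]
    (S : Set M) (hS : Nat.card S = Fintype.card V) [Finite M] :
    Nat.card {f : V → M // Function.Injective f ∧ Set.range f = S} =
      (Fintype.card V).factorial := by
  classical
  have := Fintype.ofFinite M
  let e : {f : V → M // Function.Injective f ∧ Set.range f = S} ≃ (V ≃ S) :=
    { toFun := fun f => (Equiv.ofInjective f.1 f.2.1).trans (Equiv.setCongr f.2.2)
      invFun := fun g => ⟨fun v => g v, Subtype.val_injective.comp g.injective, by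
        ext x
        constructor
        · rintro ⟨v, rfl⟩
          exact (g v).2
        · intro hx
          exact ⟨g.symm ⟨x, hx⟩, by simp⟩⟩
      left_inv := fun f => by ext v; rfl
      right_inv := fun g => by ext v; rfl }
  rw [Nat.card_congr e, Nat.card_eq_fintype_card]
  rw [Nat.card_eq_fintype_card] at hS
  exact Fintype.card_equiv (Fintype.equivOfCardEq hS.symm)

theorem card_insert_none_image_some {E : Type*} [Finite E] (F : Set E) :
    Nat.card (insert none (some '' F) : Set (Option E)) = Nat.card F + 1 := by
  rw [Nat.card_coe_set_eq, Set.ncard_insert_of_notMem (by simp),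
    Set.ncard_image_of_injective _ (Option.some_injective _), Nat.card_coe_set_eq]

namespace Graph

variable {V E : Type*}

/-- `src` and `tgt` orient the multigraph `G`: every term of `V` is a vertex, every term of `E`
is an edge, and the edge `e` joins `src e` and `tgt e`. -/
structure IsOrientation (G : Graph V E) (src tgt : E → V) : Prop where
  vertexSet_eq : G.vertexSet = Set.univ
  isLink_iff : ∀ e x y, G.IsLink e x y ↔ s(x, y) = s(src e, tgt e)

/-- The oriented incidence matrix: the column of `e` is the indicator of `src e` minus the
indicator of `tgt e`. It vanishes for a loop. -/
def incidenceMat (R : Type*) [Ring R] [DecidableEq V] (src tgt : E → V) : Matrix V E R :=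
  Matrix.of fun x e => (Pi.single (src e) 1 - Pi.single (tgt e) 1 : V → R) x

/-- The oriented incidence matrix with one more column, the indicator of the root `r`. -/
def rootedIncidenceMat [DecidableEq V] (src tgt : E → V) (r : V) : Matrix V (Option E) ℤ :=
  Matrix.of fun x o => o.elim ((Pi.single r 1 : V → ℤ) x) (incidenceMat ℤ src tgt x)

variable {G : Graph V E} {src tgt : E → V}

theorem IsOrientation.edgeSet_eq (h : G.IsOrientation src tgt) : G.edgeSet = Set.univ := by
  ext e
  simp only [Set.mem_univ, iff_true]
  exact ((h.isLink_iff e (src e) (tgt e)).2 rfl).edge_mem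

theorem IsOrientation.mem_restrict (h : G.IsOrientation src tgt) (F : Set E) (x : V) :
    x ∈ (G.restrict F).vertexSet := by
  simp [h.vertexSet_eq]

theorem IsOrientation.card_vertexSet_restrict (h : G.IsOrientation src tgt) (F : Set E) :
    Nat.card (G.restrict F).vertexSet = Nat.card V := by
  have huniv : (G.restrict F).vertexSet = Set.univ := Set.eq_univ_of_forall (h.mem_restrict F)
  rw [Nat.card_coe_set_eq, huniv, Set.ncard_univ]

/-- In a simple subgraph an edge is determined by its ends. -/
theorem IsOrientation.card_edgeSet_toSimpleGraph [Finite V] (h : G.IsOrientation src tgt)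
    (F : Set E) [(G.restrict F).Simple] :
    Nat.card (G.restrict F).toSimpleGraph.edgeSet = Nat.card F := by
  have hl : ∀ e ∈ F, (G.restrict F).IsLink e (src e) (tgt e) := fun e he =>
    ⟨he, (h.isLink_iff e _ _).2 rfl⟩
  let toEdge : F → (G.restrict F).toSimpleGraph.edgeSet := fun e =>
    ⟨s(⟨src e, h.mem_restrict F _⟩, ⟨tgt e, h.mem_restrict F _⟩), by
      rw [SimpleGraph.mem_edgeSet, toSimpleGraph_adj_iff]
      exact ⟨e, hl e e.2⟩⟩
  refine (Nat.card_congr (Equiv.ofBijective toEdge ⟨?_, ?_⟩)).symm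
  · rintro ⟨e, he⟩ ⟨e', he'⟩ hee
    have h1 : s(src e, tgt e) = s(src e', tgt e') := by
      have := congrArg (fun z => Sym2.map Subtype.val z.1) hee
      simpa [toEdge] using this
    have h2 : (G.restrict F).IsLink e' (src e) (tgt e) := ⟨he', (h.isLink_iff e' _ _).2 h1⟩
    exact Subtype.ext ((hl e he).eq h2)
  · rintro ⟨z, hz⟩
    induction z with
    | h x y =>
      rw [SimpleGraph.mem_edgeSet, toSimpleGraph_adj_iff] at hz
      obtain ⟨e, he, hxy⟩ := hz
      refine ⟨⟨e, he⟩, ?_⟩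
      rw [h.isLink_iff] at hxy
      have : Function.Injective (Sym2.map (Subtype.val : (G.restrict F).vertexSet → V)) :=
        Sym2.map.injective Subtype.val_injective
      apply Subtype.ext
      apply this
      simpa [toEdge] using hxy.symm

theorem IsOrientation.card_add_one_of_isSpanningTree [Finite V]
    (h : G.IsOrientation src tgt) {F : Set E} (hF : G.IsSpanningTree F) :
    Nat.card F + 1 = Nat.card V := by
  obtain ⟨-, hs, ht⟩ := hF
  have : Finite (G.restrict F).vertexSet := Subtype.finite
  rw [SimpleGraph.isTree_iff_connected_and_card, h.card_edgeSet_toSimpleGraph,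
    h.card_vertexSet_restrict] at ht
  exact ht.2

section

variable [Fintype V] [DecidableEq V] {r : V}

open Matrix in
/-- If the edges selected by `f` connect all vertices to the root, then every standard basis
vector is an integral combination of the selected columns, so their matrix is invertible over
the integers. -/
theorem IsOrientation.isUnit_det_of_preconnected (h : G.IsOrientation src tgt) {F : Set E}
    (hF : (G.restrict F).toSimpleGraph.Preconnected) {f : V → Option E}
    (hn : none ∈ Set.range f) (hf : ∀ e ∈ F, some e ∈ Set.range f) :
    IsUnit ((rootedIncidenceMat src tgt r).submatrix id f).det := by
  set N := (rootedIncidenceMat src tgt r).submatrix id f with hN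
  let S : Submodule ℤ (V → ℤ) := LinearMap.range N.mulVecLin
  have hcol : ∀ i, N.col i ∈ S := fun i => ⟨Pi.single i 1, by simp⟩
  have hr : (Pi.single r 1 : V → ℤ) ∈ S := by
    obtain ⟨i, hi⟩ := hn
    convert hcol i
    ext x
    simp [hN, hi, rootedIncidenceMat]
  have he : ∀ e ∈ F, (Pi.single (src e) 1 - Pi.single (tgt e) 1 : V → ℤ) ∈ S := by
    intro e heF
    obtain ⟨i, hi⟩ := hf e heF
    convert hcol i
    ext x
    simp [hN, hi, rootedIncidenceMat, incidenceMat]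
  have hadj : ∀ x y : (G.restrict F).vertexSet, (G.restrict F).toSimpleGraph.Adj x y →
      (Pi.single (x : V) 1 - Pi.single (y : V) 1 : V → ℤ) ∈ S := by
    rintro x y ⟨-, e, heF, hxy⟩
    rw [h.isLink_iff, Sym2.eq_iff] at hxy
    obtain ⟨h1, h2⟩ | ⟨h1, h2⟩ := hxy
    · rw [h1, h2]; exact he e heF
    · rw [h1, h2, ← neg_sub]; exact S.neg_mem (he e heF)
  have hreach : ∀ x : (G.restrict F).vertexSet, (Pi.single (x : V) 1 : V → ℤ) ∈ S := by
    intro x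
    obtain ⟨p⟩ := hF x ⟨r, h.mem_restrict F r⟩
    generalize hz : (⟨r, h.mem_restrict F r⟩ : (G.restrict F).vertexSet) = z at p
    induction p with
    | nil => rw [← hz]; exact hr
    | cons hxy _ ih => simpa using S.add_mem (hadj _ _ hxy) (ih hz)
  choose P hP using fun x : V => hreach ⟨x, h.mem_restrict F x⟩
  have : N * (Matrix.of P)ᵀ = 1 := by
    ext x y
    have := congrFun (hP y) x
    simp only [Matrix.mulVecLin_apply, Matrix.mulVec, dotProduct] at this
    simp [Matrix.mul_apply, this, Matrix.one_apply, Pi.single_apply]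
  exact isUnit_det_of_right_inverse this

variable [Finite E]

open Matrix in
/-- The converse direction: each way in which the selected columns can fail to form a spanning tree
and the root column produces a vector in the kernel, on the left or on the right. -/
theorem IsOrientation.isSpanningTree_of_det_ne_zero (h : G.IsOrientation src tgt)
    {f : V → Option E}
    (hdet : ((rootedIncidenceMat src tgt r).submatrix id f).det ≠ 0) :
    Function.Injective f ∧ none ∈ Set.range f ∧ G.IsSpanningTree {e | some e ∈ Set.range f} := by
  set N := (rootedIncidenceMat src tgt r).submatrix id f with hN
  set F : Set E := {e | some e ∈ Set.range f} with hF
  have hker : ∀ v : V → ℤ, N *ᵥ v = 0 → v = 0 := by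
    intro v hv
    by_contra hv0
    exact hdet (exists_mulVec_eq_zero_iff.1 ⟨v, hv0, hv⟩)
  have hker' : ∀ v : V → ℤ, v ᵥ* N = 0 → v = 0 := by
    intro v hv
    by_contra hv0
    exact hdet (exists_vecMul_eq_zero_iff.1 ⟨v, hv0, hv⟩)
  have hnone : ∀ i x, f i = none → N x i = (Pi.single r 1 : V → ℤ) x := by
    intro i x hi; simp [hN, hi, rootedIncidenceMat]
  have hsome : ∀ i x e, f i = some e →
      N x i = (Pi.single (src e) 1 - Pi.single (tgt e) 1 : V → ℤ) x := by
    intro i x e hi; simp [hN, hi, rootedIncidenceMat, incidenceMat]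
  have hvec : ∀ (v : V → ℤ) i e, f i = some e → (v ᵥ* N) i = v (src e) - v (tgt e) := by
    intro v i e hi
    simp [Matrix.vecMul, dotProduct, hsome i _ e hi, mul_sub, Finset.sum_sub_distrib,
      Pi.single_apply]
  have hvecn : ∀ (v : V → ℤ) i, f i = none → (v ᵥ* N) i = v r := by
    intro v i hi
    simp [Matrix.vecMul, dotProduct, hnone i _ hi, Pi.single_apply]
  have hinj : Function.Injective f := by
    intro i j hij
    by_contra hne
    exact hdet (det_zero_of_column_eq hne fun x => by simp [hN, hij])
  have hnr : none ∈ Set.range f := by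
    by_contra hno
    -- without the root column all columns sum to zero
    have h1 := hker' 1 (by
      ext i
      cases hi : f i with
      | none => exact absurd ⟨i, hi⟩ hno
      | some e => simp [hvec 1 i e hi])
    simpa using congrFun h1 r
  have hloop : ∀ e ∈ F, src e ≠ tgt e := by
    rintro e ⟨i, hi⟩ hst
    exact hdet (det_eq_zero_of_column_eq_zero i fun x => by simp [hsome i x e hi, hst])
  have hsimple : (G.restrict F).Simple :=
    { not_isLoopAt := by
        rintro e x ⟨he, hx⟩
        rw [h.isLink_iff, Sym2.eq_iff] at hx
        have := hloop e he
        grind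
      eq_of_isLink := by
        rintro e e' x y ⟨⟨i, hi⟩, hxy⟩ ⟨⟨j, hj⟩, hxy'⟩
        by_contra hne
        have hij : i ≠ j := by rintro rfl; exact hne (by simpa [hi] using hj)
        rw [h.isLink_iff] at hxy hxy'
        rw [hxy, Sym2.eq_iff] at hxy'
        obtain ⟨h1, h2⟩ | ⟨h1, h2⟩ := hxy'
        · exact hdet (det_zero_of_column_eq hij fun x => by
            rw [hsome i x e hi, hsome j x e' hj, h1, h2])
        · have h0 := hker (Pi.single i 1 + Pi.single j 1) (by
            ext x
            rw [Matrix.mulVec_add]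
            simp [hsome i x e hi, hsome j x e' hj, h1, h2])
          simpa [hij] using congrFun h0 i }
  have hconn : (G.restrict F).toSimpleGraph.Preconnected := by
    let r' : (G.restrict F).vertexSet := ⟨r, h.mem_restrict F r⟩
    suffices hs : ∀ x, (G.restrict F).toSimpleGraph.Reachable r' x from
      fun x y => (hs x).symm.trans (hs y)
    by_contra! hx
    obtain ⟨x, hx⟩ := hx
    classical
    -- the indicator of the vertices that the root does not reach is orthogonal to every column
    let v : V → ℤ := fun y =>
      if (G.restrict F).toSimpleGraph.Reachable r' ⟨y, h.mem_restrict F y⟩ then 0 else 1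
    have h0 := hker' v (by
      ext i
      cases hi : f i with
      | none => rw [hvecn v i hi]; simp [v, r']
      | some e =>
        rw [hvec v i e hi]
        have heF : e ∈ F := ⟨i, hi⟩
        have hadj : (G.restrict F).toSimpleGraph.Adj ⟨src e, h.mem_restrict F _⟩
            ⟨tgt e, h.mem_restrict F _⟩ := by
          rw [toSimpleGraph_adj_iff]
          exact ⟨e, heF, (h.isLink_iff e _ _).2 rfl⟩
        have : (G.restrict F).toSimpleGraph.Reachable r' ⟨src e, h.mem_restrict F _⟩ ↔
            (G.restrict F).toSimpleGraph.Reachable r' ⟨tgt e, h.mem_restrict F _⟩ :=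
          ⟨fun hh => hh.trans hadj.reachable, fun hh => hh.trans hadj.symm.reachable⟩
        simp [v, this])
    have h1 := congrFun h0 x
    simp only [v, Pi.zero_apply] at h1
    rw [if_neg hx] at h1
    exact one_ne_zero h1
  refine ⟨hinj, hnr, by simp [h.edgeSet_eq], hsimple, ?_⟩
  have : Finite (G.restrict F).vertexSet := Subtype.finite
  -- a connected graph with one edge less than vertices is a tree
  rw [SimpleGraph.isTree_iff_connected_and_card, h.card_edgeSet_toSimpleGraph]
  refine ⟨{ preconnected := hconn, nonempty := ⟨⟨r, h.mem_restrict F r⟩⟩ }, ?_⟩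
  have hFe : Nat.card F + 1 = Nat.card V := by
    have e1 : Nat.card (Set.range f) = Nat.card V := Nat.card_range_of_injective hinj
    have e2 : Set.range f = insert none (some '' F) := by
      ext o
      cases o with
      | none => simpa using hnr
      | some e => simp [hF]
    rw [← e1, e2, card_insert_none_image_some]
  rw [hFe, h.card_vertexSet_restrict]

open Classical in
/-- The square of the minor selected by `f` is `1` if `f` enumerates the root column and the edges
of a spanning tree, and `0` otherwise. It is written as a sum over the spanning trees, of which at
most one has a nonzero term, so that the sum over `f` can be interchanged with it. -/
theorem IsOrientation.sq_det_eq_sum (h : G.IsOrientation src tgt) (f : V → Option E) :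
    ((rootedIncidenceMat src tgt r).submatrix id f).det ^ 2 =
      ∑ F ∈ (Set.toFinite {F | G.IsSpanningTree F}).toFinset,
        if Function.Injective f ∧ Set.range f = insert none (some '' F) then (1 : ℤ) else 0 := by
  have hunit : ∀ F, G.IsSpanningTree F → Set.range f = insert none (some '' F) →
      ((rootedIncidenceMat src tgt r).submatrix id f).det ^ 2 = 1 := by
    intro F hF hf
    have := h.isUnit_det_of_preconnected (r := r) hF.2.2.connected.preconnected
      (f := f) (by simp [hf]) (fun e he => by simp [hf, he])
    rw [Int.isUnit_iff] at this
    rcases this with h1 | h1 <;> rw [h1] <;> norm_num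
  by_cases hdet : ((rootedIncidenceMat src tgt r).submatrix id f).det = 0
  · rw [hdet, eq_comm, zero_pow two_ne_zero]
    refine Finset.sum_eq_zero fun F hF => if_neg fun hf => ?_
    have := hunit F (by simpa using hF) hf.2
    simp [hdet] at this
  · obtain ⟨hinj, hn, ht⟩ := h.isSpanningTree_of_det_ne_zero hdet
    have hrange : Set.range f = insert none (some '' {e | some e ∈ Set.range f}) := by
      ext o
      cases o with
      | none => simpa using hn
      | some e => simp
    rw [hunit _ ht hrange, Finset.sum_eq_single {e | some e ∈ Set.range f}]
    · rw [if_pos ⟨hinj, hrange⟩]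
    · intro F _ hne
      refine if_neg fun hf => hne ?_
      ext e
      simp [hf.2]
    · exact fun hF => absurd ((Set.toFinite {F | G.IsSpanningTree F}).mem_toFinset.2 ht) hF

end

/-- Kirchhoff's matrix-tree theorem. The left side is the determinant of the Laplacian with `1`
added at the diagonal entry of the root, which is the principal minor at the root. -/
theorem IsOrientation.det_rootedIncidenceMat_mul_transpose
    [Fintype V] [DecidableEq V] [Fintype E] (h : G.IsOrientation src tgt) (r : V) :
    (rootedIncidenceMat src tgt r * (rootedIncidenceMat src tgt r).transpose).det =
      G.numSpanningTrees := by
  classical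
  have hfac : ((Fintype.card V).factorial : ℤ) ≠ 0 := by exact_mod_cast Nat.factorial_ne_zero _
  apply mul_left_cancel₀ hfac
  rw [Matrix.factorial_mul_det_mul]
  have h1 : ∀ f : V → Option E, ((rootedIncidenceMat src tgt r).submatrix id f).det *
      ((rootedIncidenceMat src tgt r).transpose.submatrix f id).det =
      ∑ F ∈ (Set.toFinite {F | G.IsSpanningTree F}).toFinset,
        if Function.Injective f ∧ Set.range f = insert none (some '' F) then (1 : ℤ) else 0 := by
    intro f
    rw [← h.sq_det_eq_sum (r := r) f, ← Matrix.transpose_submatrix, Matrix.det_transpose, sq]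
  rw [Finset.sum_congr rfl fun f _ => h1 f, Finset.sum_comm]
  have h2 : ∀ F ∈ (Set.toFinite {F | G.IsSpanningTree F}).toFinset,
      (∑ f : V → Option E, if Function.Injective f ∧
        Set.range f = insert none (some '' F) then (1 : ℤ) else 0) =
      (Fintype.card V).factorial := by
    intro F hF
    have hF' : G.IsSpanningTree F := by simpa using hF
    rw [Finset.sum_boole, ← card_injective_range_eq (insert none (some '' F)),
      Nat.card_eq_fintype_card, Fintype.card_subtype]
    rw [card_insert_none_image_some, h.card_add_one_of_isSpanningTree hF',
      Nat.card_eq_fintype_card]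
  rw [Finset.sum_congr rfl h2, Finset.sum_const, numSpanningTrees,
    Set.ncard_eq_toFinset_card _ (Set.toFinite _)]
  simp [mul_comm]

theorem IsOrientation.laplacian_eq [Fintype V] [DecidableEq V] [Fintype E]
    (h : G.IsOrientation src tgt) :
    G.laplacian = incidenceMat ℝ src tgt * (incidenceMat ℝ src tgt).transpose := by
  classical
  have hcount : ∀ x y, (G.linkCount x y : ℝ) =
      ∑ e, if s(x, y) = s(src e, tgt e) then 1 else 0 := by
    intro x y
    rw [linkCount, Finset.sum_boole, Set.ncard_eq_toFinset_card']
    simp [h.isLink_iff]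
  have hdeg : ∀ x, ∑ y, (G.linkCount x y : ℝ) =
      ∑ e, if x = src e ∨ x = tgt e then 1 else 0 := by
    intro x
    simp_rw [hcount]
    rw [Finset.sum_comm]
    refine Finset.sum_congr rfl fun e _ => ?_
    by_cases h1 : x = src e
    · rw [if_pos (Or.inl h1), Finset.sum_eq_single (tgt e)] <;> grind [Sym2.eq_iff]
    · by_cases h2 : x = tgt e
      · rw [if_pos (Or.inr h2), Finset.sum_eq_single (src e)] <;> grind [Sym2.eq_iff]
      · rw [if_neg (by tauto)]
        exact Finset.sum_eq_zero fun y _ => if_neg (by rw [Sym2.eq_iff]; tauto)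
  ext x y
  rw [laplacian, Matrix.sub_apply, Matrix.of_apply, Matrix.diagonal_apply, hdeg, hcount,
    Matrix.mul_apply]
  split_ifs with hxy
  · subst hxy
    rw [← Finset.sum_sub_distrib]
    refine Finset.sum_congr rfl fun e _ => ?_
    simp only [incidenceMat, Matrix.transpose_apply, Matrix.of_apply, Pi.sub_apply,
      Pi.single_apply, Sym2.eq_iff]
    split_ifs <;> grind
  · rw [zero_sub, ← Finset.sum_neg_distrib]
    refine Finset.sum_congr rfl fun e _ => ?_
    simp only [incidenceMat, Matrix.transpose_apply, Matrix.of_apply, Pi.sub_apply,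
      Pi.single_apply, Sym2.eq_iff]
    split_ifs <;> grind

end Graph

namespace Graph

variable {V E : Type*} {G : Graph V E} {src tgt : E → V}

open Matrix in
/-- The matrix-tree theorem for the Laplacian regularised by the all-ones matrix. -/
theorem IsOrientation.det_laplacian_add_ones [Fintype V] [DecidableEq V] [Fintype E] [Nonempty V]
    (h : G.IsOrientation src tgt) :
    (G.laplacian + Matrix.of fun _ _ => (1 : ℝ)).det =
      (Fintype.card V : ℝ) ^ 2 * G.numSpanningTrees := by
  obtain ⟨r⟩ := ‹Nonempty V›
  set N : Matrix V (Option E) ℝ := (rootedIncidenceMat src tgt r).map (Int.cast : ℤ → ℝ) with hN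
  have hnone : ∀ x, N x none = if x = r then 1 else 0 := fun x => by
    simp [hN, rootedIncidenceMat, Pi.single_apply]
  have hsome : ∀ x e, N x (some e) = incidenceMat ℝ src tgt x e := fun x e => by
    simp [hN, rootedIncidenceMat, incidenceMat, Pi.single_apply]
  have hτ : (N * Nᵀ).det = G.numSpanningTrees := by
    have hdet := congrArg (Int.castRingHom ℝ) (h.det_rootedIncidenceMat_mul_transpose r)
    rw [RingHom.map_det, RingHom.mapMatrix_apply, Matrix.map_mul, map_natCast,
      Matrix.transpose_map] at hdet
    exact hdet
  -- right multiplication by `M` turns the row `r` of `Nᵀ` into the all-ones row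
  -- and fixes the rows of the edges
  let l : V → ℝ := fun x => if x = r then 0 else 1
  let u : V → ℝ := fun _ => 1
  let K : Matrix V V ℝ := vecMulVec u l
  let M : Matrix V V ℝ := 1 + K
  have hM : M.det = Fintype.card V := by
    have hl : l = 1 - Pi.single r 1 := by
      ext x
      simp only [l, Pi.sub_apply, Pi.one_apply, Pi.single_apply]
      split_ifs <;> simp
    have hMu : M = 1 + replicateCol Unit u * replicateRow Unit l :=
      congrArg (fun A : Matrix V V ℝ => 1 + A) (vecMulVec_eq Unit u l)
    rw [hMu, det_one_add_replicateCol_mul_replicateRow, hl]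
    simp [dotProduct, u]
  have hK : ∀ o x, (Nᵀ * M) o x = o.elim 1 fun e => incidenceMat ℝ src tgt x e := by
    intro o x
    have : (Nᵀ * M) o x = N x o + (∑ y, N y o) * l x := by
      have h1 : Nᵀ * M = Nᵀ + Nᵀ * K := by rw [Matrix.mul_add, Matrix.mul_one]
      rw [h1, Matrix.add_apply, Matrix.mul_apply]
      simp [K, u, vecMulVec_apply, Finset.sum_mul]
    rw [this]
    cases o with
    | none => simp only [hnone, l]; split_ifs <;> simp
    | some e => simp [hsome, incidenceMat, Finset.sum_sub_distrib]
  have hL : G.laplacian + Matrix.of (fun _ _ => (1 : ℝ)) = Mᵀ * (N * Nᵀ) * M := by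
    have : Mᵀ * (N * Nᵀ) * M = (Nᵀ * M)ᵀ * (Nᵀ * M) := by
      simp [Matrix.transpose_mul, Matrix.mul_assoc]
    rw [this, h.laplacian_eq]
    ext x y
    rw [Matrix.mul_apply, Fintype.sum_option]
    simp [hK, Matrix.mul_apply, add_comm]
  rw [hL, det_mul, det_mul, det_transpose, hM, hτ]
  ring

end Graph

/-! ### Fourier diagonalisation of the circulant Laplacian -/

/-- The symbol of the circulant Laplacian, its eigenvalue at the frequency `w`; on `n` vertices the
frequencies are `2πj/n`. -/
def circSymbol {d : ℕ} (p : Fin d → ℕ) (w : ℝ) : ℝ := ∑ i, (2 - 2 * Real.cos (p i * w))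

theorem circulantMultigraph_isOrientation {d : ℕ} (n : ℕ) (p : Fin d → ℕ) :
    (circulantMultigraph n p).IsOrientation (fun e => e.1)
      (fun e => ⟨((e.1 : ℕ) + p e.2) % n, Nat.mod_lt _ e.1.pos⟩) where
  vertexSet_eq := rfl
  isLink_iff _ _ _ := Iff.rfl

section Fourier

open Matrix ComplexConjugate

/-- The primitive `n`-th root of unity `exp (2πi/n)`. -/
def unityRoot (n : ℕ) : ℂ := Complex.exp (2 * Real.pi * Complex.I / n)

/-- The matrix of the discrete Fourier transform, not normalised. -/
def fourierMat (n : ℕ) : Matrix (Fin n) (Fin n) ℂ :=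
  Matrix.of fun v j => unityRoot n ^ ((v : ℕ) * j)

variable (n : ℕ)

theorem unityRoot_pow (m : ℕ) :
    unityRoot n ^ m = Complex.exp ((2 * Real.pi * m / n : ℝ) * Complex.I) := by
  rw [unityRoot, ← Complex.exp_nat_mul]
  congr 1
  push_cast
  ring

theorem conj_unityRoot_pow_mul (m : ℕ) : conj (unityRoot n ^ m) * unityRoot n ^ m = 1 := by
  rw [mul_comm, Complex.mul_conj, Complex.normSq_eq_norm_sq, unityRoot_pow,
    Complex.norm_exp_ofReal_mul_I]
  simp

theorem conj_one_sub_mul_one_sub (m : ℕ) :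
    conj (1 - unityRoot n ^ m) * (1 - unityRoot n ^ m) =
      ((2 - 2 * Real.cos (2 * Real.pi * m / n) : ℝ) : ℂ) := by
  have h := conj_unityRoot_pow_mul n m
  have h2 : unityRoot n ^ m + conj (unityRoot n ^ m) =
      ((2 * Real.cos (2 * Real.pi * m / n) : ℝ) : ℂ) := by
    rw [Complex.add_conj, unityRoot_pow, Complex.exp_ofReal_mul_I_re]
  rw [Complex.ofReal_sub, ← h2, map_sub, map_one, Complex.ofReal_ofNat]
  linear_combination h

variable [NeZero n]

theorem isPrimitiveRoot_unityRoot : IsPrimitiveRoot (unityRoot n) n :=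
  Complex.isPrimitiveRoot_exp n (NeZero.ne n)

theorem sum_conj_mul_unityRoot (j k : Fin n) :
    ∑ v : Fin n, conj (unityRoot n ^ ((v : ℕ) * j)) * unityRoot n ^ ((v : ℕ) * k) =
      if j = k then (n : ℂ) else 0 := by
  split_ifs with hjk
  · subst hjk
    simp [conj_unityRoot_pow_mul n, -map_pow]
  · set z := conj (unityRoot n ^ (j : ℕ)) * unityRoot n ^ (k : ℕ) with hz
    have hω := (isPrimitiveRoot_unityRoot n).pow_eq_one
    have hzn : z ^ n = 1 := by
      rw [hz, mul_pow, ← map_pow, ← pow_mul, ← pow_mul, mul_comm (j : ℕ), mul_comm (k : ℕ),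
        pow_mul, pow_mul, hω]
      simp
    have hz1 : z ≠ 1 := by
      intro h1
      apply hjk
      apply Fin.ext
      apply (isPrimitiveRoot_unityRoot n).pow_inj j.2 k.2
      have h0 : conj (unityRoot n ^ (j : ℕ)) ≠ 0 := by
        intro h0
        have := conj_unityRoot_pow_mul n j
        simp [h0] at this
      exact mul_left_cancel₀ h0 ((conj_unityRoot_pow_mul n j).trans h1.symm)
    have : ∀ v : Fin n, conj (unityRoot n ^ ((v : ℕ) * j)) * unityRoot n ^ ((v : ℕ) * k) =
        z ^ (v : ℕ) := by
      intro v
      rw [hz, mul_pow, ← map_pow, ← pow_mul, ← pow_mul, mul_comm (j : ℕ), mul_comm (k : ℕ)]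
    rw [Finset.sum_congr rfl fun v _ => this v, Fin.sum_univ_eq_sum_range (fun v => z ^ v)]
    have := mul_geom_sum z n
    rw [hzn, sub_self] at this
    exact (mul_eq_zero.1 this).resolve_left (sub_ne_zero.2 hz1)

theorem fourierMat_conjTranspose_mul : (fourierMat n)ᴴ * fourierMat n = (n : ℂ) • 1 := by
  ext j k
  simp only [Matrix.mul_apply, Matrix.smul_apply, Matrix.one_apply, fourierMat, Matrix.of_apply,
    Matrix.conjTranspose_apply, Complex.star_def, smul_eq_mul, mul_ite, mul_one, mul_zero]
  exact sum_conj_mul_unityRoot n j k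

variable {n} in
/-- A matrix that the discrete Fourier transform diagonalises is similar to the diagonal matrix.
The inverse `W'` of the Fourier matrix is kept abstract. -/
theorem exists_inverse_of_fourierMat {A : Matrix (Fin n) (Fin n) ℂ} {D : Fin n → ℂ}
    (h : (fourierMat n)ᴴ * A * fourierMat n = (n : ℂ) • diagonal D) :
    ∃ W' : Matrix (Fin n) (Fin n) ℂ, W' * fourierMat n = 1 ∧
      A = fourierMat n * (diagonal D * W') := by
  have hn : (n : ℂ) ≠ 0 := by exact_mod_cast NeZero.ne n
  have h1 : ((n : ℂ)⁻¹ • (fourierMat n)ᴴ) * fourierMat n = 1 := by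
    rw [Matrix.smul_mul, fourierMat_conjTranspose_mul, smul_smul, inv_mul_cancel₀ hn, one_smul]
  refine ⟨(n : ℂ)⁻¹ • (fourierMat n)ᴴ, h1, ?_⟩
  have h2 := mul_eq_one_comm.1 h1
  have h3 : diagonal D = ((n : ℂ)⁻¹ • (fourierMat n)ᴴ) * A * fourierMat n := by
    rw [Matrix.smul_mul, Matrix.smul_mul, h, smul_smul, inv_mul_cancel₀ hn, one_smul]
  rw [h3]
  generalize (n : ℂ)⁻¹ • (fourierMat n)ᴴ = W' at *
  rw [← Matrix.mul_assoc, ← Matrix.mul_assoc, ← Matrix.mul_assoc, h2, Matrix.one_mul,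
    Matrix.mul_assoc, h2, Matrix.mul_one]

variable {d : ℕ} (p : Fin d → ℕ)

theorem fourierMat_mul_laplacian_mul :
    (fourierMat n)ᴴ * (circulantMultigraph n p).laplacian.map Complex.ofReal * fourierMat n =
      (n : ℂ) • diagonal fun j : Fin n => ((circSymbol p (2 * Real.pi * j / n) : ℝ) : ℂ) := by
  have hL := (circulantMultigraph_isOrientation n p).laplacian_eq
  set B := Graph.incidenceMat ℝ (fun e : Fin n × Fin d => e.1)
    (fun e => ⟨((e.1 : ℕ) + p e.2) % n, Nat.mod_lt _ e.1.pos⟩) with hB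
  set C := B.map Complex.ofReal with hC
  have hCC : (circulantMultigraph n p).laplacian.map Complex.ofReal = C * Cᴴ := by
    ext x y
    simp [hL, hC, Matrix.mul_apply]
  have hsingle : ∀ (u : Fin n) (F : Fin n → ℂ),
      ∑ x, (((Pi.single u 1 : Fin n → ℝ) x : ℝ) : ℂ) * F x = F u := by
    intro u F
    rw [Finset.sum_eq_single u] <;> simp +contextual
  have hCW : ∀ e j, (Cᴴ * fourierMat n) e j =
      unityRoot n ^ ((e.1 : ℕ) * j) * (1 - unityRoot n ^ (p e.2 * j)) := by
    intro e j
    have h1 : (Cᴴ * fourierMat n) e j = unityRoot n ^ ((e.1 : ℕ) * j) -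
        unityRoot n ^ ((((e.1 : ℕ) + p e.2) % n) * j) := by
      simp only [Matrix.mul_apply, Matrix.conjTranspose_apply, hC, hB, Graph.incidenceMat,
        Matrix.map_apply, Matrix.of_apply, Pi.sub_apply, Complex.star_def, Complex.ofReal_sub,
        map_sub, Complex.conj_ofReal, sub_mul, Finset.sum_sub_distrib, hsingle, fourierMat]
    have h2 : unityRoot n ^ ((((e.1 : ℕ) + p e.2) % n) * j) =
        unityRoot n ^ (((e.1 : ℕ) + p e.2) * j) := by
      rw [pow_mul, pow_mul, ← pow_eq_pow_mod _ (isPrimitiveRoot_unityRoot n).pow_eq_one]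
    rw [h1, h2, add_mul, pow_add]
    ring
  -- the Gram matrix of the rows `ω ^ (v j) (1 - ω ^ (p i j))` is a product of a sum over `v` and
  -- a sum over `i`
  have hfac : (fourierMat n)ᴴ * (C * Cᴴ) * fourierMat n =
      (Cᴴ * fourierMat n)ᴴ * (Cᴴ * fourierMat n) := by
    simp [Matrix.conjTranspose_mul, Matrix.mul_assoc]
  rw [hCC, hfac]
  ext j k
  have h3 : ((Cᴴ * fourierMat n)ᴴ * (Cᴴ * fourierMat n)) j k =
      (∑ v : Fin n, conj (unityRoot n ^ ((v : ℕ) * j)) * unityRoot n ^ ((v : ℕ) * k)) *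
        ∑ i, conj (1 - unityRoot n ^ (p i * j)) * (1 - unityRoot n ^ (p i * k)) := by
    rw [Matrix.mul_apply, Fintype.sum_prod_type, Finset.sum_mul_sum]
    refine Finset.sum_congr rfl fun v _ => Finset.sum_congr rfl fun i _ => ?_
    rw [Matrix.conjTranspose_apply, hCW, hCW, Complex.star_def, map_mul]
    ring
  rw [h3, sum_conj_mul_unityRoot, Matrix.smul_apply, Matrix.diagonal_apply, smul_eq_mul]
  split_ifs with hjk
  · subst hjk
    rw [Finset.sum_congr rfl fun i _ => conj_one_sub_mul_one_sub n (p i * j), circSymbol,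
      Complex.ofReal_sum]
    congr 1
    refine Finset.sum_congr rfl fun i _ => ?_
    congr 4
    push_cast
    ring
  · simp

theorem fourierMat_mul_ones_mul :
    (fourierMat n)ᴴ * (Matrix.of fun _ _ => (1 : ℂ)) * fourierMat n =
      (n : ℂ) • diagonal fun j : Fin n => if j = 0 then (n : ℂ) else 0 := by
  have h : ∀ k : Fin n, ∑ v : Fin n, unityRoot n ^ ((v : ℕ) * k) =
      if k = 0 then (n : ℂ) else 0 := by
    intro k
    have := sum_conj_mul_unityRoot n 0 k
    simpa [eq_comm] using this
  have h' : ∀ k : Fin n, ∑ v : Fin n, conj (unityRoot n ^ ((v : ℕ) * k)) =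
      if k = 0 then (n : ℂ) else 0 := by
    intro k
    rw [← map_sum, h]
    split_ifs <;> simp
  ext j k
  rw [Matrix.mul_assoc, Matrix.mul_apply]
  simp only [Matrix.mul_apply, Matrix.of_apply, one_mul, ← Finset.sum_mul, fourierMat, h,
    Matrix.conjTranspose_apply, Complex.star_def, h', Matrix.smul_apply, Matrix.diagonal_apply,
    smul_eq_mul]
  split_ifs <;> grind

theorem charpoly_laplacian_circulant :
    (circulantMultigraph n p).laplacian.charpoly =
      ∏ j : Fin n, (Polynomial.X - Polynomial.C (circSymbol p (2 * Real.pi * j / n))) := by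
  apply Polynomial.map_injective Complex.ofRealHom Complex.ofReal_injective
  obtain ⟨W', h1, h2⟩ := exists_inverse_of_fourierMat (fourierMat_mul_laplacian_mul n p)
  rw [← Matrix.charpoly_map]
  have h3 : (circulantMultigraph n p).laplacian.map Complex.ofRealHom =
    (circulantMultigraph n p).laplacian.map Complex.ofReal := rfl
  rw [h3, h2, Matrix.charpoly_mul_comm, Matrix.mul_assoc, h1, Matrix.mul_one,
    Matrix.charpoly_diagonal, Polynomial.map_prod]
  simp

theorem detStar_circulant :
    (circulantMultigraph n p).detStar =
      ∏ j : Fin n with circSymbol p (2 * Real.pi * ((j : Fin n) : ℕ) / n) ≠ 0,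
        circSymbol p (2 * Real.pi * j / n) := by
  classical
  set f : Fin n → ℝ := fun j => circSymbol p (2 * Real.pi * (j : ℕ) / n) with hf
  have h := (circulantMultigraph n p).isHermitian_laplacian.roots_charpoly_eq_eigenvalues
  have h1 : (circulantMultigraph n p).laplacian.charpoly.roots =
      Finset.univ.val.map f := by
    rw [charpoly_laplacian_circulant, ← Polynomial.roots_multiset_prod_X_sub_C
      (Finset.univ.val.map f), Multiset.map_map]
    rfl
  rw [h1] at h
  have key : ∀ g : Fin n → ℝ, ∏ j : Fin n with g j ≠ 0, g j =
      ((Finset.univ.val.map g).filter (· ≠ 0)).prod := by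
    intro g
    rw [Finset.prod, Finset.filter_val, Multiset.filter_map]
    rfl
  rw [Graph.detStar, key f, h, key]
  rfl

/-- The all-ones matrix only moves the eigenvalue of the constant functions, from `0` to `n`. -/
theorem det_laplacian_add_ones_circulant :
    ((circulantMultigraph n p).laplacian + Matrix.of fun _ _ => (1 : ℝ)).det =
      n * ∏ j : Fin n with j ≠ 0, circSymbol p (2 * Real.pi * j / n) := by
  have h : (fourierMat n)ᴴ * (((circulantMultigraph n p).laplacian +
      Matrix.of fun _ _ => (1 : ℝ)).map Complex.ofReal) * fourierMat n =
      (n : ℂ) • diagonal fun j : Fin n =>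
        (((if j = 0 then (n : ℝ) else circSymbol p (2 * Real.pi * j / n)) : ℝ) : ℂ) := by
    have : ((circulantMultigraph n p).laplacian + Matrix.of fun _ _ => (1 : ℝ)).map
        Complex.ofReal = (circulantMultigraph n p).laplacian.map Complex.ofReal +
          Matrix.of fun _ _ => (1 : ℂ) := by
      ext i j; simp
    rw [this, Matrix.mul_add, Matrix.add_mul, fourierMat_mul_laplacian_mul,
      fourierMat_mul_ones_mul, ← smul_add, Matrix.diagonal_add]
    congr 2
    ext j
    split_ifs with hj
    · simp [hj, circSymbol]
    · simp
  obtain ⟨W', h1, h2⟩ := exists_inverse_of_fourierMat h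
  apply Complex.ofReal_injective
  have h3 : ((((circulantMultigraph n p).laplacian + Matrix.of fun _ _ => (1 : ℝ)).det : ℝ) : ℂ) =
      (((circulantMultigraph n p).laplacian + Matrix.of fun _ _ => (1 : ℝ)).map
        Complex.ofReal).det := by
    exact RingHom.map_det Complex.ofRealHom _
  rw [h3, h2, Matrix.det_mul_comm, Matrix.mul_assoc, h1, Matrix.mul_one, Matrix.det_diagonal,
    ← Complex.ofReal_prod, ← Finset.mul_prod_erase _ _ (Finset.mem_univ (0 : Fin n)), if_pos rfl,
    Finset.filter_ne']
  congr 2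
  exact Finset.prod_congr rfl fun j hj => if_neg (Finset.ne_of_mem_erase hj)

variable {n p} in
theorem circSymbol_ne_zero (hp : ∃ i, p i = 1) {j : Fin n} (hj : j ≠ 0) :
    circSymbol p (2 * Real.pi * j / n) ≠ 0 := by
  obtain ⟨i, hi⟩ := hp
  have hnonneg : ∀ x : ℝ, 0 ≤ 2 - 2 * Real.cos x := fun x => by
    linarith [Real.cos_le_one x]
  have h1 : 1 - unityRoot n ^ (j : ℕ) ≠ 0 := by
    intro h
    apply hj
    apply Fin.ext
    apply (isPrimitiveRoot_unityRoot n).pow_inj j.2 (0 : Fin n).2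
    simpa using (sub_eq_zero.1 h).symm
  have h2 := conj_one_sub_mul_one_sub n j
  have h3 : 2 - 2 * Real.cos (2 * Real.pi * j / n) ≠ 0 := by
    intro h0
    rw [h0, Complex.ofReal_zero, mul_eq_zero, map_eq_zero, or_self] at h2
    exact h1 h2
  refine (Finset.sum_pos' (fun i _ => hnonneg _) ⟨i, Finset.mem_univ i, ?_⟩).ne'
  rw [hi, Nat.cast_one, one_mul]
  exact lt_of_le_of_ne (hnonneg _) h3.symm

theorem detStar_circulant_eq_prod (hp : ∃ i, p i = 1) :
    (circulantMultigraph n p).detStar =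
      ∏ j : Fin n with j ≠ 0, circSymbol p (2 * Real.pi * j / n) := by
  rw [detStar_circulant]
  congr 1
  ext j
  simp only [Finset.mem_filter_univ]
  refine ⟨?_, circSymbol_ne_zero hp⟩
  rintro h rfl
  simp [circSymbol] at h

/-- The matrix-tree theorem in its eigenvalue form: both sides times `n` are the determinant of
the Laplacian plus the all-ones matrix. -/
theorem detStar_circulant_eq_mul_numSpanningTrees (hp : ∃ i, p i = 1) :
    (circulantMultigraph n p).detStar = n * (circulantMultigraph n p).numSpanningTrees := by
  have h1 := (circulantMultigraph_isOrientation n p).det_laplacian_add_ones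
  rw [det_laplacian_add_ones_circulant, Fintype.card_fin, ← detStar_circulant_eq_prod n p hp] at h1
  have hn : (n : ℝ) ≠ 0 := by exact_mod_cast NeZero.ne n
  apply mul_left_cancel₀ hn
  rw [h1]
  ring

end Fourier

/-! ### The reduced symbol and Riemann sums -/

/-- The quotient of the symbol `circSymbol (generators γ)` by `2 - 2 cos w = |1 - exp (i w)|²`. -/
def reducedSymbol {k : ℕ} (γ : Fin k → ℕ) (w : ℝ) : ℝ :=
  1 + ∑ i, ‖∑ j ∈ Finset.range (γ i), Complex.exp (w * Complex.I) ^ j‖ ^ 2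

section

variable {k : ℕ} (γ : Fin k → ℕ)

theorem norm_one_sub_exp_sq (w : ℝ) :
    ‖1 - Complex.exp (w * Complex.I)‖ ^ 2 = 2 - 2 * Real.cos w := by
  rw [← Complex.normSq_eq_norm_sq, Complex.normSq_apply]
  simp only [Complex.sub_re, Complex.one_re, Complex.sub_im, Complex.one_im,
    Complex.exp_ofReal_mul_I_re, Complex.exp_ofReal_mul_I_im]
  linear_combination Real.sin_sq_add_cos_sq w

theorem circSymbol_generators (w : ℝ) :
    circSymbol (generators γ) w = (2 - 2 * Real.cos w) * reducedSymbol γ w := by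
  have h : ∀ m : ℕ, 2 - 2 * Real.cos (m * w) =
      (2 - 2 * Real.cos w) * ‖∑ j ∈ Finset.range m, Complex.exp (w * Complex.I) ^ j‖ ^ 2 := by
    intro m
    rw [← norm_one_sub_exp_sq, ← norm_one_sub_exp_sq, ← mul_pow, ← norm_mul, mul_neg_geom_sum,
      ← Complex.exp_nat_mul]
    congr 4
    push_cast
    ring
  rw [circSymbol, Fin.sum_univ_succ, reducedSymbol, mul_add, mul_one, Finset.mul_sum]
  simp [generators, h]

theorem one_le_reducedSymbol (w : ℝ) : 1 ≤ reducedSymbol γ w := by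
  rw [reducedSymbol]
  linarith [Finset.sum_nonneg fun i (_ : i ∈ Finset.univ) => sq_nonneg
    ‖∑ j ∈ Finset.range (γ i), Complex.exp (w * Complex.I) ^ j‖]

theorem reducedSymbol_pos (w : ℝ) : 0 < reducedSymbol γ w :=
  zero_lt_one.trans_le (one_le_reducedSymbol γ w)

theorem reducedSymbol_zero : reducedSymbol γ 0 = circConst γ := by
  simp [reducedSymbol, circConst]

theorem reducedSymbol_add_two_pi (w : ℝ) :
    reducedSymbol γ (w + 2 * Real.pi) = reducedSymbol γ w := by
  have : Complex.exp ((w + 2 * Real.pi : ℝ) * Complex.I) = Complex.exp (w * Complex.I) := by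
    rw [← Complex.exp_periodic (w * Complex.I)]
    congr 1
    push_cast
    ring
  rw [reducedSymbol, this, reducedSymbol]

theorem contDiff_reducedSymbol {N : WithTop ℕ∞} : ContDiff ℝ N (reducedSymbol γ) := by
  unfold reducedSymbol
  refine contDiff_const.add
    (ContDiff.sum fun i _ => ContDiff.norm_sq ℝ (ContDiff.sum fun j _ => ?_))
  exact ((Complex.ofRealCLM.contDiff.mul contDiff_const).cexp).pow j

theorem contDiff_log_reducedSymbol {N : WithTop ℕ∞} :
    ContDiff ℝ N fun w => Real.log (reducedSymbol γ w) :=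
  (contDiff_reducedSymbol γ).log fun w => (reducedSymbol_pos γ w).ne'

/-- For a smooth periodic function the trapezoidal rule is the Riemann sum over equidistant
points, and its error is of second order. -/
theorem tendsto_sum_sub_integral_of_periodic {f : ℝ → ℝ} (hf : ContDiff ℝ 2 f) {T : ℝ}
    (hT : 0 < T) (hp : f T = f 0) :
    Tendsto (fun n : ℕ => ∑ j ∈ Finset.range n, f (T * j / n) - n / T * ∫ x in (0 : ℝ)..T, f x)
      atTop (nhds 0) := by
  have hcont : ContinuousOn (iteratedDerivWithin 2 f (Set.uIcc 0 T)) (Set.uIcc 0 T) :=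
    hf.contDiffOn.continuousOn_iteratedDerivWithin le_rfl
      (by rw [Set.uIcc_of_le hT.le]; exact uniqueDiffOn_Icc hT)
  obtain ⟨ζ, hζ⟩ := isCompact_uIcc.exists_bound_of_continuousOn hcont
  have hζ0 : 0 ≤ ζ := (norm_nonneg _).trans (hζ 0 Set.left_mem_uIcc)
  -- outside the interval the derivative within the interval is zero by convention
  have hbound : ∀ x, |iteratedDerivWithin 2 f (Set.uIcc 0 T) x| ≤ ζ := by
    intro x
    by_cases hx : x ∈ Set.uIcc 0 T
    · exact hζ x hx
    · rw [iteratedDerivWithin_succ, derivWithin_zero_of_notMem_closure, abs_zero]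
      · exact hζ0
      · rwa [isCompact_uIcc.isClosed.closure_eq]
  have hlim : Tendsto (fun n : ℕ => T ^ 2 * ζ / 12 / n) atTop (nhds 0) :=
    tendsto_const_div_atTop_nhds_zero_nat _
  refine squeeze_zero_norm' ?_ hlim
  filter_upwards [eventually_gt_atTop 0] with n hn
  have hn' : (0 : ℝ) < n := by exact_mod_cast hn
  have herr := trapezoidal_error_le_of_c2 hf.contDiffOn hbound hn
  have htrap : trapezoidal_integral f n 0 T = T / n * ∑ j ∈ Finset.range n, f (T * j / n) := by
    obtain ⟨m, rfl⟩ := Nat.exists_eq_succ_of_ne_zero hn.ne'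
    have hterm : ∀ j : ℕ, f (0 + (j + 1) * (T - 0) / (m + 1 : ℕ)) =
        f (T * (j + 1 : ℕ) / (m + 1 : ℕ)) := by
      intro j
      congr 1
      push_cast
      ring
    rw [trapezoidal_integral, hp, Finset.sum_range_succ', Nat.succ_eq_add_one,
      Nat.add_sub_cancel, Finset.sum_congr rfl fun j _ => hterm j]
    simp [add_comm]
  have heq : ∑ j ∈ Finset.range n, f (T * j / n) - n / T * ∫ x in (0 : ℝ)..T, f x =
      n / T * trapezoidal_error f n 0 T := by
    rw [trapezoidal_error, htrap]
    field_simp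
  rw [heq, Real.norm_eq_abs, abs_mul, abs_of_pos (by positivity)]
  calc n / T * |trapezoidal_error f n 0 T|
      ≤ n / T * (|T - 0| ^ 3 * ζ / (12 * n ^ 2)) := by gcongr
    _ = T ^ 2 * ζ / 12 / n := by
      rw [sub_zero, abs_of_pos hT]
      field_simp

theorem prod_two_sub_two_cos (n : ℕ) [NeZero n] :
    ∏ j : Fin n with j ≠ 0, (2 - 2 * Real.cos (2 * Real.pi * j / n)) = (n : ℝ) ^ 2 := by
  obtain ⟨m, rfl⟩ := Nat.exists_eq_succ_of_ne_zero (NeZero.ne n)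
  have h := (isPrimitiveRoot_unityRoot (m + 1)).prod_one_sub_pow_eq_order
  have h2 : ∏ j ∈ Finset.range m, (2 - 2 * Real.cos (2 * Real.pi * (j + 1 : ℕ) / (m + 1 : ℕ))) =
      ((m + 1 : ℕ) : ℝ) ^ 2 := by
    apply Complex.ofReal_injective
    rw [Complex.ofReal_prod, ← Finset.prod_congr rfl fun j _ =>
      conj_one_sub_mul_one_sub (m + 1) (j + 1), Finset.prod_mul_distrib, ← map_prod, h]
    simp [sq]
  rw [← h2, Finset.prod_range, Finset.prod_filter, Fin.prod_univ_succ]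
  simp [Fin.succ_ne_zero]

/-- The sum on the right runs over all `n` equidistant points. The term `j = 0`, which is not
an eigenvalue factor, is `log (circConst γ)` and is subtracted. -/
theorem log_detStar_circulant (n : ℕ) [NeZero n] :
    Real.log (circulantMultigraph n (generators γ)).detStar =
      2 * Real.log n - Real.log (circConst γ) +
        ∑ j ∈ Finset.range n, Real.log (reducedSymbol γ (2 * Real.pi * j / n)) := by
  have hn : (n : ℝ) ≠ 0 := by exact_mod_cast NeZero.ne n
  rw [detStar_circulant_eq_prod n _ ⟨0, rfl⟩,
    Finset.prod_congr rfl fun j _ => circSymbol_generators γ _, Finset.prod_mul_distrib,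
    prod_two_sub_two_cos, Real.log_mul (pow_ne_zero _ hn)
      (Finset.prod_ne_zero_iff.2 fun j _ => (reducedSymbol_pos γ _).ne'),
    Real.log_pow, Real.log_prod fun j _ => (reducedSymbol_pos γ _).ne',
    Finset.sum_range fun j => Real.log (reducedSymbol γ (2 * Real.pi * (j : ℕ) / n)),
    ← Finset.add_sum_erase _ _ (Finset.mem_univ (0 : Fin n)), Finset.filter_ne']
  simp only [Fin.val_zero, Nat.cast_zero, mul_zero, zero_div, reducedSymbol_zero]
  push_cast
  ring

end

/-! ### Frullani's integral with a parameter -/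

/-- The Frullani integrand of the exponential function is nonnegative and exponentially small. -/
theorem exp_sub_exp_div_mem_bounds {a b : ℝ} (hab : a ≤ b) {t : ℝ} (ht : 0 < t) :
    0 ≤ (Real.exp (-(a * t)) - Real.exp (-(b * t))) / t ∧
      (Real.exp (-(a * t)) - Real.exp (-(b * t))) / t ≤ (b - a) * Real.exp (-a * t) := by
  have h1 : Real.exp (-(b * t)) = Real.exp (-a * t) * Real.exp (-((b - a) * t)) := by
    rw [← Real.exp_add]; congr 1; ring
  have h2 := Real.add_one_le_exp (-((b - a) * t))
  have h3 : Real.exp (-((b - a) * t)) ≤ 1 :=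
    Real.exp_le_one_iff.2 (by nlinarith [sub_nonneg.2 hab])
  have h4 := Real.exp_pos (-a * t)
  have h5 : Real.exp (-(a * t)) = Real.exp (-a * t) := by congr 1; ring
  rw [h1, h5]
  refine ⟨div_nonneg (by nlinarith) ht.le, ?_⟩
  rw [div_le_iff₀ ht]
  nlinarith

/-- The Frullani integrand of the exponential function. -/
def frullaniExp (a b t : ℝ) : ℝ := (Real.exp (-(a * t)) - Real.exp (-(b * t))) / t

theorem measurable_frullaniExp : Measurable fun z : ℝ × ℝ × ℝ => frullaniExp z.1 z.2.1 z.2.2 := by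
  unfold frullaniExp
  fun_prop

theorem frullaniExp_symm (a b t : ℝ) : frullaniExp a b t = -frullaniExp b a t := by
  rw [frullaniExp, frullaniExp]
  ring

theorem integrableOn_frullaniExp {a b : ℝ} (ha : 0 < a) (hb : 0 < b) :
    IntegrableOn (frullaniExp a b) (Set.Ioi 0) := by
  wlog hab : a ≤ b generalizing a b
  · have := (this hb ha (le_of_not_ge hab)).neg
    refine this.congr (Eventually.of_forall fun t => ?_)
    rw [frullaniExp_symm a b, Pi.neg_apply]
  refine Integrable.mono' ((integrableOn_exp_mul_Ioi (neg_lt_zero.2 ha) 0).const_mul (b - a)) ?_ ?_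
  · exact (measurable_frullaniExp.comp (by fun_prop :
      Measurable fun t : ℝ => (a, b, t))).aestronglyMeasurable
  · filter_upwards [ae_restrict_mem measurableSet_Ioi] with t ht
    obtain ⟨h1, h2⟩ := exp_sub_exp_div_mem_bounds hab ht
    rw [frullaniExp, Real.norm_eq_abs, abs_of_nonneg h1]
    exact h2

theorem integral_frullaniExp {a b : ℝ} (ha : 0 < a) (hb : 0 < b) :
    ∫ t in Set.Ioi 0, frullaniExp a b t = Real.log (b / a) := by
  have hcont : Continuous fun x : ℝ => Real.exp (-x) := by fun_prop
  have h0 : Tendsto (fun x : ℝ => Real.exp (-x)) (nhdsWithin 0 (Set.Ioi 0)) (nhds 1) := by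
    have := (hcont.tendsto 0).mono_left (nhdsWithin_le_nhds (s := Set.Ioi 0))
    simpa using this
  have heq : ∀ t, t⁻¹ • (Real.exp (-(a * t)) - Real.exp (-(b * t))) = frullaniExp a b t :=
    fun t => by rw [frullaniExp, smul_eq_mul, div_eq_inv_mul]
  have h := Frullani.integral_Ioi_eq (f := fun x : ℝ => Real.exp (-x))
    (hcont.locallyIntegrable.locallyIntegrableOn _) ha hb h0 Real.tendsto_exp_neg_atTop_nhds_zero
    (by simpa only [heq] using integrableOn_frullaniExp ha hb)
  simpa only [heq, sub_zero, smul_eq_mul, mul_one] using h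

theorem integral_abs_frullaniExp {a b : ℝ} (ha : 0 < a) (hb : 0 < b) :
    ∫ t in Set.Ioi 0, |frullaniExp a b t| = |Real.log (b / a)| := by
  wlog hab : a ≤ b generalizing a b
  · have := this hb ha (le_of_not_ge hab)
    rw [← inv_div b a, Real.log_inv, abs_neg] at this
    rw [← this]
    congr 1
    ext t
    rw [frullaniExp_symm a b, abs_neg]
  rw [abs_of_nonneg (Real.log_nonneg ((one_le_div ha).2 hab)), ← integral_frullaniExp ha hb]
  refine setIntegral_congr_fun measurableSet_Ioi fun t ht => abs_of_nonneg ?_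
  exact (exp_sub_exp_div_mem_bounds hab ht).1

section

variable {α : Type*} [MeasurableSpace α] {μ : Measure α}

/-- Frullani's integral, integrated over a parameter. The integrand has a constant sign for each
value of the parameter, which gives absolute convergence. -/
theorem integrable_prod_frullaniExp {s : α → ℝ} (hs : Measurable s) (hpos : ∀ᵐ w ∂μ, 0 < s w)
    (hlog : Integrable (fun w => Real.log (s w)) μ) :
    Integrable (fun z : α × ℝ => frullaniExp 1 (s z.1) z.2)
      (μ.prod (volume.restrict (Set.Ioi 0))) := by
  have hm : Measurable fun z : α × ℝ => frullaniExp 1 (s z.1) z.2 :=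
    measurable_frullaniExp.comp (by fun_prop : Measurable fun z : α × ℝ => ((1 : ℝ), s z.1, z.2))
  rw [integrable_prod_iff hm.aestronglyMeasurable]
  refine ⟨?_, ?_⟩
  · filter_upwards [hpos] with w hw using integrableOn_frullaniExp one_pos hw
  · refine hlog.abs.congr ?_
    filter_upwards [hpos] with w hw
    have := integral_abs_frullaniExp one_pos hw
    rw [div_one] at this
    exact this.symm

theorem integral_integral_frullaniExp [SFinite μ] {s : α → ℝ} (hs : Measurable s)
    (hpos : ∀ᵐ w ∂μ, 0 < s w) (hlog : Integrable (fun w => Real.log (s w)) μ) :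
    ∫ t in Set.Ioi 0, ∫ w, frullaniExp 1 (s w) t ∂μ = ∫ w, Real.log (s w) ∂μ := by
  rw [← integral_integral_swap (integrable_prod_frullaniExp hs hpos hlog)]
  refine integral_congr_ae ?_
  filter_upwards [hpos] with w hw
  simpa using integral_frullaniExp one_pos hw

end

/-! ### The lead term as a Mahler measure -/

section

variable {k : ℕ} (γ : Fin k → ℕ)

theorem continuous_circSymbol {d : ℕ} (p : Fin d → ℕ) : Continuous (circSymbol p) := by
  unfold circSymbol
  fun_prop

theorem two_sub_two_cos_two_mul (x : ℝ) :
    2 - 2 * Real.cos (2 * x) = (2 * Real.sin x) ^ 2 := by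
  rw [Real.cos_two_mul, mul_pow, Real.sin_sq]
  ring

theorem log_two_sub_two_cos_two_mul {x : ℝ} (hx : Real.sin x ≠ 0) :
    Real.log (2 - 2 * Real.cos (2 * x)) = 2 * Real.log 2 + 2 * Real.log (Real.sin x) := by
  rw [two_sub_two_cos_two_mul, Real.log_pow, Real.log_mul two_ne_zero hx]
  push_cast
  ring

theorem ae_two_sub_two_cos_pos : ∀ᵐ w : ℝ, 0 < 2 - 2 * Real.cos w := by
  filter_upwards [(Set.countable_range fun n : ℤ => (n : ℝ) * (2 * Real.pi)).ae_notMem volume]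
    with w hw
  have h1 : Real.cos w ≠ 1 := fun h => hw ((Real.cos_eq_one_iff w).1 h)
  linarith [lt_of_le_of_ne (Real.cos_le_one w) h1]

theorem intervalIntegrable_log_two_sub_two_cos (a b : ℝ) :
    IntervalIntegrable (fun w => Real.log (2 - 2 * Real.cos w)) volume a b := by
  have : AnalyticOnNhd ℝ (fun w : ℝ => 2 - 2 * Real.cos w) (Set.uIcc a b) := fun x _ =>
    analyticAt_const.sub (analyticAt_const.mul Real.analyticAt_cos)
  exact this.meromorphicOn.intervalIntegrable_log

theorem integral_log_two_sub_two_cos :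
    ∫ w in (0 : ℝ)..(2 * Real.pi), Real.log (2 - 2 * Real.cos w) = 0 := by
  have h := intervalIntegral.integral_comp_mul_left
    (fun w => Real.log (2 - 2 * Real.cos w)) (two_ne_zero (α := ℝ)) (a := 0) (b := Real.pi)
  rw [mul_zero] at h
  have h2 : ∫ x in (0 : ℝ)..Real.pi, Real.log (2 - 2 * Real.cos (2 * x)) =
      ∫ x in (0 : ℝ)..Real.pi, (2 * Real.log 2 + 2 * Real.log (Real.sin x)) :=
    intervalIntegral.integral_congr_Ioo_of_le Real.pi_pos.le fun x hx =>
      log_two_sub_two_cos_two_mul (Real.sin_pos_of_mem_Ioo hx).ne'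
  have h3 : IntervalIntegrable (fun x => Real.log (Real.sin x)) volume 0 Real.pi :=
    intervalIntegrable_log_sin
  rw [h2, intervalIntegral.integral_add intervalIntegrable_const (h3.const_mul 2),
    intervalIntegral.integral_const, intervalIntegral.integral_const_mul,
    integral_log_sin_zero_pi] at h
  have h4 : (2 : ℝ)⁻¹ • ∫ w in (0 : ℝ)..(2 * Real.pi), Real.log (2 - 2 * Real.cos w) = 0 := by
    rw [← h, smul_eq_mul]
    ring
  simpa using h4

theorem circSymbol_generators_pos_ae : ∀ᵐ w : ℝ, 0 < circSymbol (generators γ) w := by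
  filter_upwards [ae_two_sub_two_cos_pos] with w hw
  rw [circSymbol_generators]
  exact mul_pos hw (reducedSymbol_pos γ w)

theorem log_circSymbol_generators_ae :
    ∀ᵐ w : ℝ, Real.log (2 - 2 * Real.cos w) + Real.log (reducedSymbol γ w) =
      Real.log (circSymbol (generators γ) w) := by
  filter_upwards [ae_two_sub_two_cos_pos] with w hw
  rw [circSymbol_generators, Real.log_mul hw.ne' (reducedSymbol_pos γ w).ne']

theorem intervalIntegrable_log_reducedSymbol (a b : ℝ) :
    IntervalIntegrable (fun w => Real.log (reducedSymbol γ w)) volume a b :=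
  (contDiff_log_reducedSymbol γ (N := 0)).continuous.intervalIntegrable a b

theorem intervalIntegrable_log_circSymbol (a b : ℝ) :
    IntervalIntegrable (fun w => Real.log (circSymbol (generators γ) w)) volume a b :=
  ((intervalIntegrable_log_two_sub_two_cos a b).add
    (intervalIntegrable_log_reducedSymbol γ a b)).congr_ae
    (ae_restrict_of_ae (log_circSymbol_generators_ae γ))

theorem integral_log_circSymbol :
    ∫ w in (-Real.pi)..Real.pi, Real.log (circSymbol (generators γ) w) =
      ∫ w in (0 : ℝ)..(2 * Real.pi), Real.log (reducedSymbol γ w) := by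
  have hper : Function.Periodic (fun w => Real.log (circSymbol (generators γ) w))
      (2 * Real.pi) := fun w => by
    simp only [circSymbol_generators, reducedSymbol_add_two_pi, Real.cos_add_two_pi]
  have h := hper.intervalIntegral_add_eq (-Real.pi) 0
  rw [show -Real.pi + 2 * Real.pi = Real.pi by ring, zero_add] at h
  rw [h, ← intervalIntegral.integral_congr_ae
    ((log_circSymbol_generators_ae γ).mono fun w hw _ => hw),
    intervalIntegral.integral_add (intervalIntegrable_log_two_sub_two_cos _ _)
      (intervalIntegrable_log_reducedSymbol γ _ _), integral_log_two_sub_two_cos, zero_add]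

theorem leadIntegrand_eq {d : ℕ} (p : Fin d → ℕ) (t : ℝ) :
    leadIntegrand p t = 1 / (2 * Real.pi) *
      ∫ w in Set.Ioc (-Real.pi) Real.pi, frullaniExp 1 (circSymbol p w) t := by
  have hle : -Real.pi ≤ Real.pi := by linarith [Real.pi_pos]
  have hexp : ∀ w, Real.exp (-(circSymbol p w * t)) =
      Real.exp (-(2 * (d : ℝ) * t)) * Real.exp (∑ i, 2 * t * Real.cos (p i * w)) := by
    intro w
    rw [← Real.exp_add, ← Finset.mul_sum, circSymbol, Finset.sum_sub_distrib, ← Finset.mul_sum]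
    congr 1
    simp
    ring
  have hint : IntervalIntegrable (fun w => Real.exp (-(circSymbol p w * t))) volume
      (-Real.pi) Real.pi := by
    have := continuous_circSymbol p
    exact (by fun_prop : Continuous _).intervalIntegrable _ _
  rw [← intervalIntegral.integral_of_le hle]
  simp only [frullaniExp]
  rw [intervalIntegral.integral_div, intervalIntegral.integral_sub intervalIntegrable_const hint,
    intervalIntegral.integral_const]
  simp only [hexp]
  rw [intervalIntegral.integral_const_mul, leadIntegrand, besselIZero]
  have := Real.pi_pos.ne'
  rw [one_mul, smul_eq_mul]
  field_simp
  ring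

theorem integrableOn_log_circSymbol :
    IntegrableOn (fun w => Real.log (circSymbol (generators γ) w))
      (Set.Ioc (-Real.pi) Real.pi) :=
  (intervalIntegrable_log_circSymbol γ _ _).1

theorem integrableOn_leadIntegrand :
    IntegrableOn (leadIntegrand (generators γ)) (Set.Ioi 0) := by
  have h := (integrable_prod_frullaniExp (continuous_circSymbol (generators γ)).measurable
    (ae_restrict_of_ae (circSymbol_generators_pos_ae γ))
    (integrableOn_log_circSymbol γ)).integral_prod_right
  exact (h.const_mul (1 / (2 * Real.pi))).congr
    (Eventually.of_forall fun t => (leadIntegrand_eq _ t).symm)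

/-- The lead term is the logarithmic Mahler measure of the symbol. The factor `2 - 2 cos w` has
Mahler measure `1`, so it is also the mean of the logarithm of the reduced symbol. -/
theorem leadTerm_eq :
    leadTerm (generators γ) =
      1 / (2 * Real.pi) * ∫ w in (0 : ℝ)..(2 * Real.pi), Real.log (reducedSymbol γ w) := by
  have hle : -Real.pi ≤ Real.pi := by linarith [Real.pi_pos]
  simp only [leadTerm, leadIntegrand_eq]
  rw [integral_const_mul, integral_integral_frullaniExp
    (continuous_circSymbol (generators γ)).measurable
    (ae_restrict_of_ae (circSymbol_generators_pos_ae γ)) (integrableOn_log_circSymbol γ),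
    ← intervalIntegral.integral_of_le hle, integral_log_circSymbol]

theorem tendsto_log_detStar :
    Tendsto (fun n : ℕ => Real.log (circulantMultigraph n (generators γ)).detStar -
      ((n : ℝ) * leadTerm (generators γ) + 2 * Real.log n - Real.log (circConst γ)))
      atTop (nhds 0) := by
  have hper : Real.log (reducedSymbol γ (2 * Real.pi)) = Real.log (reducedSymbol γ 0) := by
    rw [← reducedSymbol_add_two_pi γ 0, zero_add]
  refine (tendsto_sum_sub_integral_of_periodic (contDiff_log_reducedSymbol γ)
    Real.two_pi_pos hper).congr' ?_
  filter_upwards [eventually_gt_atTop 0] with n hn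
  have : NeZero n := ⟨hn.ne'⟩
  rw [log_detStar_circulant, leadTerm_eq]
  ring

end

/-! ### Asymptotics of the number of spanning trees -/

section

variable {k : ℕ} (γ : Fin k → ℕ)

theorem detStar_circulant_pos (n : ℕ) [NeZero n] :
    0 < (circulantMultigraph n (generators γ)).detStar := by
  rw [detStar_circulant_eq_prod n _ ⟨0, rfl⟩]
  refine Finset.prod_pos fun j hj => lt_of_le_of_ne ?_
    (circSymbol_ne_zero ⟨0, rfl⟩ (Finset.mem_filter.1 hj).2).symm
  rw [circSymbol_generators]
  exact mul_nonneg (by linarith [Real.cos_le_one (2 * Real.pi * j / n)])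
    (reducedSymbol_pos γ _).le

theorem circConst_pos : 0 < circConst γ := by
  rw [← reducedSymbol_zero]
  exact reducedSymbol_pos γ 0

theorem isEquivalent_numSpanningTrees :
    (fun n : ℕ => ((circulantMultigraph n (generators γ)).numSpanningTrees : ℝ))
      ~[atTop] (fun n : ℕ =>
        (n : ℝ) / circConst γ * Real.exp ((n : ℝ) * leadTerm (generators γ))) := by
  have hc := circConst_pos γ
  refine isEquivalent_of_tendsto_one ?_
  have h := (Real.continuous_exp.tendsto 0).comp (tendsto_log_detStar γ)
  rw [Real.exp_zero] at h
  refine h.congr' ?_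
  filter_upwards [eventually_gt_atTop 0] with n hn
  have : NeZero n := ⟨hn.ne'⟩
  have hn' : (0 : ℝ) < n := by exact_mod_cast hn
  have hpos := detStar_circulant_pos γ n
  rw [Function.comp_apply, Real.exp_sub, Real.exp_log hpos, Real.exp_sub, Real.exp_add,
    Real.exp_log hc, two_mul, Real.exp_add, Real.exp_log hn',
    detStar_circulant_eq_mul_numSpanningTrees n _ ⟨0, rfl⟩, Pi.div_apply]
  have := Real.exp_pos (n * leadTerm (generators γ))
  field_simp

end

/-- Consecutive terms have the ratio `r`, so the nonzero limit forces `r = 1`. -/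
theorem eq_one_of_tendsto_const_mul_pow {K r : ℝ}
    (h : Tendsto (fun n : ℕ => K * r ^ n) atTop (nhds 1)) : K = 1 := by
  have h1 : Tendsto (fun n : ℕ => K * r ^ (n + 1)) atTop (nhds 1) :=
    (tendsto_add_atTop_iff_nat (f := fun n : ℕ => K * r ^ n) 1).2 h
  have h2 : Tendsto (fun n : ℕ => K * r ^ (n + 1)) atTop (nhds (r * 1)) :=
    (h.const_mul r).congr fun n => by ring
  have hr : r = 1 := by simpa using (tendsto_nhds_unique h1 h2).symm
  simpa [hr] using h

section

variable {T a : ℕ → ℝ} {C I : ℝ}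

theorem tendsto_sq_div_of_isEquivalent (hC : 0 < C)
    (hT : T ~[atTop] fun n : ℕ => (n : ℝ) / C * Real.exp (n * I))
    (ha : ∀ᶠ n : ℕ in atTop, T n = n * a n ^ 2) :
    Tendsto (fun n : ℕ => a n ^ 2 / (1 / C * Real.exp I ^ n)) atTop (nhds 1) := by
  rw [isEquivalent_iff_tendsto_one] at hT
  · refine hT.congr' ?_
    filter_upwards [ha, eventually_gt_atTop 0] with n hn h0
    have hn' : (0 : ℝ) < n := by exact_mod_cast h0
    rw [Pi.div_apply, hn, Real.exp_nat_mul]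
    have := Real.exp_pos I
    field_simp
  · filter_upwards [eventually_gt_atTop 0] with n h0
    have hn' : (0 : ℝ) < n := by exact_mod_cast h0
    positivity

theorem isEquivalent_of_tendsto_sq_div (hC : 0 < C)
    (h : Tendsto (fun n : ℕ => a n ^ 2 / (1 / C * Real.exp I ^ n)) atTop (nhds 1))
    (ha : ∀ᶠ n : ℕ in atTop, 0 ≤ a n) :
    a ~[atTop] fun n : ℕ => (√C)⁻¹ * Real.exp (I / 2) ^ n := by
  refine isEquivalent_of_tendsto_one ?_
  have h1 := (Real.continuous_sqrt.tendsto 1).comp h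
  rw [Real.sqrt_one] at h1
  refine h1.congr' ?_
  filter_upwards [ha] with n hn
  have he : 1 / C * Real.exp I ^ n = ((√C)⁻¹ * Real.exp (I / 2) ^ n) ^ 2 := by
    have hI : Real.exp I = Real.exp (I / 2) ^ 2 := by
      rw [← Real.exp_nat_mul]
      congr 1
      push_cast
      ring
    rw [mul_pow, inv_pow, Real.sq_sqrt hC.le, hI, ← pow_mul, ← pow_mul, mul_comm n 2, one_div]
  rw [Function.comp_apply, he, ← div_pow, Real.sqrt_sq (by positivity), Pi.div_apply]

theorem sq_eq_of_isEquivalent_const_mul_pow (hC : 0 < C)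
    (h : Tendsto (fun n : ℕ => a n ^ 2 / (1 / C * Real.exp I ^ n)) atTop (nhds 1)) {c φ : ℝ}
    (ha : a ~[atTop] fun n : ℕ => c * φ ^ n) : c ^ 2 = 1 / C := by
  have hne : ∀ n : ℕ, 1 / C * Real.exp I ^ n ≠ 0 := fun n => by positivity
  have h1 : (fun n : ℕ => a n ^ 2) ~[atTop] fun n : ℕ => 1 / C * Real.exp I ^ n :=
    isEquivalent_of_tendsto_one h
  have h2 : (fun n : ℕ => (c * φ ^ n) ^ 2) ~[atTop] fun n : ℕ => 1 / C * Real.exp I ^ n :=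
    (ha.pow 2).symm.trans h1
  rw [isEquivalent_iff_tendsto_one (Eventually.of_forall hne)] at h2
  have h3 : c ^ 2 * C = 1 := by
    refine eq_one_of_tendsto_const_mul_pow (r := φ ^ 2 / Real.exp I) (h2.congr fun n => ?_)
    have := Real.exp_pos I
    rw [Pi.div_apply, div_pow]
    field_simp
    ring
  rw [eq_div_iff hC.ne', h3]

end

end

theorem theorem1 (k : ℕ) (γ : Fin k → ℕ) (hγ : ∀ i, 1 ≤ γ i) :
    -- the integral of the lead term converges
    IntegrableOn (leadIntegrand (generators γ)) (Set.Ioi 0) ∧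
    -- asymptotics of the logarithm of the product of the non-zero Laplacian eigenvalues
    (fun n : ℕ => Real.log (circulantMultigraph n (generators γ)).detStar -
        ((n : ℝ) * leadTerm (generators γ) + 2 * Real.log n - Real.log (circConst γ)))
      =o[atTop] (fun _ => (1 : ℝ)) ∧
    -- asymptotics of the number of spanning trees
    (fun n : ℕ => ((circulantMultigraph n (generators γ)).numSpanningTrees : ℝ))
      ~[atTop] (fun n : ℕ =>
        (n : ℝ) / circConst γ * Real.exp ((n : ℝ) * leadTerm (generators γ))) ∧
    -- the asymptotic constant
    (∀ a : ℕ → ℝ,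
      (∀ᶠ n : ℕ in atTop,
        ((circulantMultigraph n (generators γ)).numSpanningTrees : ℝ) = n * a n ^ 2) →
      ((∀ᶠ n : ℕ in atTop, 0 ≤ a n) →
        ∃ c φ : ℝ, 0 < c ∧ 0 < φ ∧ a ~[atTop] (fun n : ℕ => c * φ ^ n)) ∧
      ∀ c φ : ℝ, a ~[atTop] (fun n : ℕ => c * φ ^ n) → c ^ 2 = 1 / circConst γ) := by
  have hc := circConst_pos γ
  refine ⟨integrableOn_leadIntegrand γ, (isLittleO_one_iff ℝ).2 (tendsto_log_detStar γ),
    isEquivalent_numSpanningTrees γ, fun a ha => ?_⟩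
  have h := tendsto_sq_div_of_isEquivalent hc (isEquivalent_numSpanningTrees γ) ha
  exact ⟨fun hpos => ⟨_, _, by positivity, by positivity, isEquivalent_of_tendsto_sq_div hc h hpos⟩,
    fun c φ hcφ => sq_eq_of_isEquivalent_const_mul_pow hc h hcφ⟩
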